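/- \textbf{Setting.} Let $X$ and $\varepsilon$ be independent real random variables, $Y := X+\varepsilon$, and let $\eta_2$ be a real random variable with distribution function (d.f.) $F_\eta$, independent of $(X,\varepsilon)$. For a random variable $B$ denote by $F_B$ its d.f. and by $\Phi_B(t) = \mathbb{E}\, e^{itB}$ its characteristic function. Assume that $F_\eta$ symmetrizes the error: with $\bar\varepsilon := \varepsilon - \eta_2$, the function $\Phi_{\bar\varepsilon} = \Phi_\varepsilon \overline{\Phi_\eta}$ is real-valued with $0 \le \Phi_{\bar\varepsilon} \le 1$ and has the same zeros in $\mathbb{R}$ as $\Phi_\varepsilon$. Let $\ddot Y := Y - \eta_2$, so that $F_{\ddot Y} = F_X * F_{\bar\varepsilon}$. Convolution powers are $F^{*0} := \mathbf{1}_{[0,\infty)}$ and $F^{*k} := F * F^{*(k-1)}$. For $\xi \in \mathbb{R}$, $m \in \mathbb{N}_0$ and $t\in\mathbb{R}$ define the deconvolution function and the $m$-power by $$\mathfrak{D}(\xi,m) := \sum_{\ell=0}^m \sum_{k=0}^{\ell} \binom{\ell}{k} (-1)^k \big(F_{\ddot Y} * F_{\bar\varepsilon}^{*k}\big)(\xi),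 \qquad \mathcal{P}_{\bar\varepsilon}(t,m) := \big(1-\Phi_{\bar\varepsilon}(t)\big)^{m+1}.$$ Let $C_{\mathfrak{D}}$ be the set of all $\xi\in\mathbb{R}$ at which $F_X * F_{\bar\varepsilon}^{*j}$ is continuous for every integer $j\ge 1$. \textbf{Theorem.} Assume the following. \begin{enumerate} \item There are $\rho>0$ and $j_{\bar\varepsilon} \in \mathbb{N}_0$ such that, for each $m \in \mathbb{N}_0$ and each fixed $t\in[0,\rho]$, the sequence $\mathcal{P}_{\bar\varepsilon}(t+j\rho,m)$ is non-decreasing or non-increasing with respect to the integer $j\ge j_{\bar\varepsilon}$. \item There are $T_0\ge 0$, a complex Borel measure $G_X$ on $\mathbb{R}$ and a function $\varphi_X : \mathbb{R}\to\mathbb{C}$ with $\Phi_X(t)=\gamma_X(t)\varphi_X(t)$ for all $t\ge T_0$, where $\gamma_X(t) := \int_{\mathbb{R}} e^{itx}\, G_X(dx)$, the measure $G_X$ has finite total variation and is purely atomic, i.e. $|G_X|(\mathbb{R})=|G_X|(D_{G_X})<\infty$ with $D_{G_X} := \{x : G_X(\{x\})\neq 0\}$, and $t\mapsto t^{-1}\varphi_X(t)$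 is continuous and of bounded variation on $[T_0,\infty)$ and tends to $0$ as $t\to\infty$. \item There is $\tau>0$ with $\int_0^\tau t^{-1}\big(1-\Phi_{\bar\varepsilon}(t)\big)\,dt<\infty$. \item The set $\{t \in \mathbb{R} : \Phi_\varepsilon(t)=0\}$ has Lebesgue measure zero. \end{enumerate} Then $$\lim_{m\to\infty}\mathfrak{D}(\xi,m) = \frac{F_X(\xi)+F_X(\xi-)}{2}$$ for every $\xi\in C_{\mathfrak{D}}$ such that $\inf\{ |(x-\xi)\rho - 2\pi k| : x\in D_{G_X},\, k\in\mathbb{Z}\} > 0$, where the infimum of the empty set is $+\infty$. -/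

import Mathlib

open MeasureTheory ProbabilityTheory Filter Topology
open scoped ENNReal

namespace Deconv

noncomputable section

/-- Convolution powers of a law on the line, with the unit mass at the origin as power `0`. -/
def convPow (ν : Measure ℝ) : ℕ → Measure ℝ
  | 0 => Measure.dirac 0
  | k + 1 => ν ∗ convPow ν k

/-- The law of `ε - η₂`, where `ε` has law `με` and `η₂` is an independent variable of law `μη`. -/
def symmErrorLaw (με μη : Measure ℝ) : Measure ℝ :=
  με ∗ μη.map (fun x => -x)

/-- The law of the observation `Y = X + ε`, with `X` and `ε` independent. -/
def obsLaw (μX με : Measure ℝ) : Measure ℝ :=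
  μX ∗ με

/-- The law of `Y - η₂`, where `η₂` has law `μη` and is independent of `Y = X + ε`. -/
def symmObsLaw (μX με μη : Measure ℝ) : Measure ℝ :=
  obsLaw μX με ∗ μη.map (fun x => -x)

/-- The law `μη` symmetrizes the error law `με`: the characteristic function of the symmetrized
error, which is `Φ_ε` times the complex conjugate of `Φ_η`, is real valued (so that the symmetrized
error is symmetric about the origin), takes its values in `[0, 1]`, and has the same zeros as `Φ_ε`.
With `Φ_ε = Φ_η Φ_δ` for some characteristic function `Φ_δ ≥ 0`, this always holds. -/
structure Symmetrizes (μη με : Measure ℝ) : Prop where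
  real_valued : ∀ t : ℝ, (charFun (symmErrorLaw με μη) t).im = 0
  mem_Icc : ∀ t : ℝ, (charFun (symmErrorLaw με μη) t).re ∈ Set.Icc (0 : ℝ) 1
  zeros : ∀ t : ℝ, charFun (symmErrorLaw με μη) t = 0 ↔ charFun με t = 0

/-- The deconvolution function `𝔇(ξ, m)`. -/
def decFun (μX με μη : Measure ℝ) (ξ : ℝ) (m : ℕ) : ℝ :=
  ∑ l ∈ Finset.range (m + 1), ∑ k ∈ Finset.range (l + 1),
    (l.choose k : ℝ) * (-1) ^ k *
      cdf (symmObsLaw μX με μη ∗ convPow (symmErrorLaw με μη) k) ξ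

/-- The `m`-power `(1 - Φ(t)) ^ (m + 1)` of a law whose characteristic function `Φ` is real. -/
def mPower (ν : Measure ℝ) (t : ℝ) (m : ℕ) : ℝ :=
  (1 - (charFun ν t).re) ^ (m + 1)

/-- The jump `Q(ξ+) - Q(ξ-)`. -/
def jump (Q : ℝ → ℝ) (ξ : ℝ) : ℝ :=
  Function.rightLim Q ξ - Function.leftLim Q ξ

/-- The set `D_𝔇` of points at which, for some `j ≥ 1`, the distribution function of the
convolution of the law of `X` with the `j`-th convolution power of the symmetrized error jumps. -/
def decAtoms (μX με μη : Measure ℝ) : Set ℝ :=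
  {ξ | ∃ j : ℕ, 1 ≤ j ∧ 0 < jump (cdf (μX ∗ convPow (symmErrorLaw με μη) j)) ξ}

/-- `C_𝔇`, the complement of `D_𝔇`. -/
def decContinuity (μX με μη : Measure ℝ) : Set ℝ :=
  (decAtoms μX με μη)ᶜ

/-- The distance of two sets of reals, with value `∞` if one of them is empty. -/
def setDist (A B : Set ℝ) : ℝ≥0∞ :=
  ⨅ a ∈ A, ⨅ b ∈ B, edist a b

/-- The set `2πℤ`. -/
def twoPiInt : Set ℝ :=
  Set.range (fun k : ℤ => 2 * Real.pi * (k : ℝ))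

/-- The `m`-powers of `ν` are monotone along arithmetic progressions of step `ρ`, from the index
`j₀` on; the direction may depend on the starting point and on `m`. -/
def MonotoneAlongProgressions (ν : Measure ℝ) (ρ : ℝ) (j₀ : ℕ) : Prop :=
  ∀ m : ℕ, ∀ t ∈ Set.Icc (0 : ℝ) ρ,
    MonotoneOn (fun j : ℕ => mPower ν (t + j * ρ) m) (Set.Ici j₀) ∨
      AntitoneOn (fun j : ℕ => mPower ν (t + j * ρ) m) (Set.Ici j₀)

/-- The integrability condition at the origin. -/
def IntegrableNearZero (ν : Measure ℝ) : Prop :=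
  ∃ τ : ℝ, 0 < τ ∧ IntegrableOn (fun t : ℝ => mPower ν t 0 / t) (Set.Ioc 0 τ)

/-- The atoms of a complex measure. -/
def atoms (G : ComplexMeasure ℝ) : Set ℝ :=
  {x | G {x} ≠ 0}

/-- The Fourier-Stieltjes transform `∫ e^{itx} G(dx)` of a complex measure. -/
def fourierStieltjes (G : ComplexMeasure ℝ) (t : ℝ) : ℂ :=
  VectorMeasure.integral G (fun x : ℝ => Complex.exp (Complex.I * (t : ℂ) * (x : ℂ)))
    (ContinuousLinearMap.mul ℝ ℂ)

/-- The factorization `Φ_X = γ_X φ_X` on `[T₀, ∞)`, where `γ_X` is the transform of the purely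
atomic measure `G` of finite total variation, and `φ_X(t) / t` is continuous, of bounded variation
and vanishes at infinity. -/
structure Factorization (μX : Measure ℝ) (T₀ : ℝ) (G : ComplexMeasure ℝ) (φ : ℝ → ℂ) :
    Prop where
  T₀_nonneg : 0 ≤ T₀
  eq_mul : ∀ t : ℝ, T₀ ≤ t → charFun μX t = fourierStieltjes G t * φ t
  finite_variation : G.variation Set.univ < ∞
  purely_atomic : G.variation Set.univ = G.variation (atoms G)
  continuousOn : ContinuousOn (fun t : ℝ => φ t / (t : ℂ)) (Set.Ici T₀)
  boundedVariation : BoundedVariationOn (fun t : ℝ => φ t / (t : ℂ)) (Set.Ici T₀)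
  tendsto_zero : Tendsto (fun t : ℝ => φ t / (t : ℂ)) atTop (𝓝 0)

end

end Deconv

/-!
The deconvolution sum telescopes (`decFun_eq`): with `ν` the law of the symmetrized error, `𝔇(·, m)`
is the distribution function of `μX - μX * (δ₀ - ν)^{*(m+1)}`. So the error `𝔇(ξ, m) - F_X(ξ)` is
governed by a signed measure of total mass `0` and characteristic function `Φ_X (1 - Φ_ν)^{m+1}`. By
the inversion formula at `ξ` (`tendsto_integral_errIntegrand`), where only the term without error
factors may jump, the deviation from the midpoint `(F_X(ξ) + F_X(ξ-)) / 2` is a constant multiple of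
`lim_{T → ∞} ∫₀ᵀ Im (e^{-itξ} Φ_X(t)) (1 - Φ_ν(t))^{m+1} / t dt`. The inversion formula comes from
Fubini's theorem and the convergence of the sine integral to a positive limit.

It remains to let `m → ∞`. On a bounded interval `[0, A]` the integral tends to `0` by dominated
convergence (`tendsto_integral_errIntegrand_zero`): `Φ_ν > 0` almost everywhere, and
`(1 - Φ_ν(t)) / t` is an integrable majorant. The tail over `[A, ∞)` need not be absolutely convergent;
it is small for large `A`, uniformly in `m`, because of cancellation
(`exists_forall_abs_integral_errIntegrand_le`). There `Φ_X(t) / t = γ(t) ψ(t)`, with `ψ = φ / t` of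
small variation and `γ` a uniform limit of finite sums `∑ G{x} e^{itx}` over atoms `x` of `G`
(`exists_finset_fourierStieltjes`). For a single atom, `[A, A + Nρ]` is cut into intervals of
length `ρ`, which leads to the sums over `j` of
`e^{ijρ(x - ξ)} ψ(s + jρ) (1 - Φ_ν(s + jρ))^{m+1}`. The last factor is monotone in `j` with values in
`[0, 1]`, so summation by parts (`norm_one_sub_mul_norm_sum_mul_le`) bounds such a sum by four times
the variation of `ψ` on `[A, ∞)` over `|1 - e^{iρ(x - ξ)}|`. The denominator is bounded below
uniformly over the atoms by the assumption on the distance from `2πℤ`.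
-/

namespace Deconv

noncomputable section

/-! ### The sine integral -/

/-- The sine integral `∫₀ᵀ (sin u) / u du`. -/
def sinInt (T : ℝ) : ℝ := ∫ u in (0 : ℝ)..T, Real.sinc u

/-- The limit of the sine integral at `∞`, written as the absolutely convergent integral
`∫₀^∞ (1 - cos u) / u² du` of a nonnegative function, from which its positivity is plain. (Its
value `π / 2` is never needed.) -/
def dirichletConst : ℝ := ∫ u in Set.Ioi (0 : ℝ), (1 - Real.cos u) / u ^ 2

lemma continuous_sinInt : Continuous sinInt :=
  intervalIntegral.continuous_primitive
    (fun _ _ => Real.continuous_sinc.intervalIntegrable _ _) 0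

lemma sinInt_zero : sinInt 0 = 0 := by simp [sinInt]

lemma sinInt_neg (T : ℝ) : sinInt (-T) = -sinInt T := by
  have h := intervalIntegral.integral_comp_neg (a := 0) (b := T) Real.sinc
  simp only [Real.sinc_neg, neg_zero] at h
  rw [sinInt, sinInt, h, intervalIntegral.integral_symm]

lemma one_sub_cos_div_sq_nonneg (u : ℝ) : 0 ≤ (1 - Real.cos u) / u ^ 2 :=
  div_nonneg (by linarith [Real.cos_le_one u]) (sq_nonneg u)

lemma one_sub_cos_div_sq_le (u : ℝ) : (1 - Real.cos u) / u ^ 2 ≤ 4 * (1 + u ^ 2)⁻¹ := by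
  rcases eq_or_ne u 0 with rfl | hu
  · simp
  have h2 : 0 < u ^ 2 := by positivity
  rw [← div_eq_mul_inv, div_le_div_iff₀ h2 (by positivity)]
  nlinarith [Real.one_sub_sq_div_two_le_cos (x := u), Real.neg_one_le_cos u]

lemma integrable_one_sub_cos_div_sq :
    Integrable (fun u : ℝ => (1 - Real.cos u) / u ^ 2) := by
  refine (integrable_inv_one_add_sq.const_mul 4).mono'
    (Measurable.aestronglyMeasurable (by fun_prop)) (ae_of_all _ fun u => ?_)
  rw [Real.norm_of_nonneg (one_sub_cos_div_sq_nonneg u)]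
  exact one_sub_cos_div_sq_le u

/-- Integration by parts. -/
lemma sinInt_eq {T : ℝ} (hT : 0 < T) :
    sinInt T = (1 - Real.cos T) / T + ∫ u in (0 : ℝ)..T, (1 - Real.cos u) / u ^ 2 := by
  have hsinc := Real.continuous_sinc.intervalIntegrable (μ := volume) 0 T
  have hint := (integrable_one_sub_cos_div_sq.intervalIntegrable (a := 0) (b := T))
  have hcont : ContinuousOn (fun u : ℝ => (1 - Real.cos u) / u) (Set.Icc 0 T) := by
    intro u hu
    rcases eq_or_ne u 0 with rfl | hne
    · -- at the origin the quotient is squeezed between `±|u| / 2`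
      apply ContinuousAt.continuousWithinAt
      have hb : ∀ u : ℝ, ‖(1 - Real.cos u) / u‖ ≤ |u| := by
        intro u
        rcases eq_or_ne u 0 with rfl | hu
        · simp
        rw [Real.norm_eq_abs, abs_div, div_le_iff₀ (abs_pos.2 hu), abs_mul_abs_self,
          abs_of_nonneg (by linarith [Real.cos_le_one u])]
        nlinarith [Real.one_sub_sq_div_two_le_cos (x := u)]
      rw [ContinuousAt]
      simp only [div_zero]
      refine squeeze_zero_norm hb ?_
      simpa using (continuous_abs.tendsto (0 : ℝ))
    · exact (ContinuousAt.div (by fun_prop) continuousAt_id hne).continuousWithinAt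
  have hder : ∀ u ∈ Set.Ioo 0 T, HasDerivAt (fun u : ℝ => (1 - Real.cos u) / u)
      (Real.sinc u - (1 - Real.cos u) / u ^ 2) u := by
    intro u hu
    have hne : u ≠ 0 := hu.1.ne'
    have h := ((hasDerivAt_const u (1 : ℝ)).sub (Real.hasDerivAt_cos u)).div (hasDerivAt_id u) hne
    refine h.congr_deriv ?_
    rw [Real.sinc_of_ne_zero hne]
    simp only [id, Pi.sub_apply]
    field_simp
    ring
  have h := intervalIntegral.integral_eq_sub_of_hasDerivAt_of_le hT.le hcont hder (hsinc.sub hint)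
  rw [intervalIntegral.integral_sub hsinc hint] at h
  simp only [div_zero, sub_zero] at h
  rw [sinInt]
  linarith

lemma tendsto_sinInt : Tendsto sinInt atTop (𝓝 dirichletConst) := by
  have h1 : Tendsto (fun T : ℝ => (1 - Real.cos T) / T) atTop (𝓝 0) := by
    refine squeeze_zero' (g := fun T : ℝ => 2 / T) ?_ ?_ (tendsto_const_nhds.div_atTop tendsto_id)
    · filter_upwards [eventually_gt_atTop 0] with T hT
      exact div_nonneg (by linarith [Real.cos_le_one T]) hT.le
    · filter_upwards [eventually_gt_atTop 0] with T hT
      gcongr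
      linarith [Real.neg_one_le_cos T]
  have h2 := intervalIntegral_tendsto_integral_Ioi (0 : ℝ)
    integrable_one_sub_cos_div_sq.integrableOn tendsto_id
  have h3 := h1.add h2
  rw [zero_add] at h3
  refine h3.congr' ?_
  filter_upwards [eventually_gt_atTop 0] with T hT
  exact (sinInt_eq hT).symm

lemma dirichletConst_pos : 0 < dirichletConst := by
  rw [dirichletConst, setIntegral_pos_iff_support_of_nonneg_ae
    (ae_of_all _ one_sub_cos_div_sq_nonneg) integrable_one_sub_cos_div_sq.integrableOn]
  have hsub : Set.Ioo (0 : ℝ) 1 ⊆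
      Function.support (fun u : ℝ => (1 - Real.cos u) / u ^ 2) ∩ Set.Ioi 0 := by
    intro u hu
    refine ⟨?_, hu.1⟩
    have hc : Real.cos u < 1 := by
      rw [← Real.cos_zero]
      exact Real.cos_lt_cos_of_nonneg_of_le_pi le_rfl (by linarith [Real.pi_gt_three, hu.2]) hu.1
    have hu0 := hu.1
    exact (div_pos (by linarith) (by positivity)).ne'
  refine lt_of_lt_of_le ?_ (measure_mono hsub)
  simp

lemma abs_sinInt_le (T : ℝ) : |sinInt T| ≤ 1 + dirichletConst := by
  have hpos : ∀ T : ℝ, 0 < T → |sinInt T| ≤ 1 + dirichletConst := by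
    intro T hT
    have h1 : 0 ≤ (1 - Real.cos T) / T := div_nonneg (by linarith [Real.cos_le_one T]) hT.le
    have h2 : (1 - Real.cos T) / T ≤ 1 := by
      rw [div_le_one hT]
      rcases le_total T 2 with h | h
      · nlinarith [Real.one_sub_sq_div_two_le_cos (x := T)]
      · linarith [Real.neg_one_le_cos T]
    have h3 : 0 ≤ ∫ u in (0 : ℝ)..T, (1 - Real.cos u) / u ^ 2 :=
      intervalIntegral.integral_nonneg hT.le fun u _ => one_sub_cos_div_sq_nonneg u
    have h4 : ∫ u in (0 : ℝ)..T, (1 - Real.cos u) / u ^ 2 ≤ dirichletConst := by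
      rw [intervalIntegral.integral_of_le hT.le]
      exact setIntegral_mono_set integrable_one_sub_cos_div_sq.integrableOn
        (ae_of_all _ one_sub_cos_div_sq_nonneg) (Set.Ioc_subset_Ioi_self).eventuallyLE
    rw [sinInt_eq hT, abs_of_nonneg (by positivity)]
    linarith
  rcases lt_trichotomy T 0 with h | rfl | h
  · have := hpos (-T) (by linarith)
    rwa [sinInt_neg, abs_neg] at this
  · rw [sinInt_zero, abs_zero]
    linarith [dirichletConst_pos]
  · exact hpos T h

lemma integral_sin_mul_div {δ T : ℝ} (hδ : 0 < δ) (hT : δ ≤ T) (y : ℝ) :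
    ∫ t in δ..T, Real.sin (t * y) / t = sinInt (T * y) - sinInt (δ * y) := by
  have h1 : ∫ t in δ..T, Real.sin (t * y) / t = ∫ t in δ..T, y * Real.sinc (t * y) := by
    refine intervalIntegral.integral_congr fun t ht => ?_
    rw [Set.uIcc_of_le hT] at ht
    have ht0 : t ≠ 0 := (hδ.trans_le ht.1).ne'
    rcases eq_or_ne y 0 with rfl | hy
    · simp
    · simp only [Real.sinc_of_ne_zero (mul_ne_zero ht0 hy)]
      field_simp
  rw [h1, intervalIntegral.integral_const_mul, intervalIntegral.mul_integral_comp_mul_right,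
    sinInt, sinInt, intervalIntegral.integral_interval_sub_left
      (Real.continuous_sinc.intervalIntegrable _ _) (Real.continuous_sinc.intervalIntegrable _ _)]

/-! ### Inversion of characteristic functions -/

lemma im_exp_mul_charFun (μ : Measure ℝ) [IsFiniteMeasure μ] (ξ t : ℝ) :
    (Complex.exp (-(t * ξ : ℝ) * Complex.I) * charFun μ t).im
      = ∫ x, Real.sin (t * (x - ξ)) ∂μ := by
  have hi : Integrable (fun x : ℝ => Complex.exp ((t * (x - ξ) : ℝ) * Complex.I)) μ := by
    refine (integrable_const (1 : ℝ)).mono' (by fun_prop) (ae_of_all _ fun x => ?_)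
    rw [Complex.norm_exp_ofReal_mul_I]
  have h : Complex.exp (-(t * ξ : ℝ) * Complex.I) * charFun μ t
      = ∫ x, Complex.exp ((t * (x - ξ) : ℝ) * Complex.I) ∂μ := by
    rw [charFun_apply_real, ← integral_const_mul]
    congr 1 with x
    rw [← Complex.exp_add]
    congr 1
    push_cast
    ring
  rw [h]
  have := integral_im (𝕜 := ℂ) hi
  simp only [Complex.exp_ofReal_mul_I_im, RCLike.im_to_complex] at this
  exact this.symm

/-- The truncated inversion integral, by Fubini's theorem. -/
lemma integral_im_exp_mul_charFun_div (μ : Measure ℝ) [IsFiniteMeasure μ] (ξ : ℝ) {δ T : ℝ}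
    (hδ : 0 < δ) (hT : δ ≤ T) :
    ∫ t in δ..T, (Complex.exp (-(t * ξ : ℝ) * Complex.I) * charFun μ t).im / t
      = ∫ x, sinInt (T * (x - ξ)) ∂μ - ∫ x, sinInt (δ * (x - ξ)) ∂μ := by
  have hint : ∀ S : ℝ, Integrable (fun x => sinInt (S * (x - ξ))) μ := fun S =>
    (integrable_const (1 + dirichletConst)).mono'
      (continuous_sinInt.comp (by fun_prop)).aestronglyMeasurable
      (ae_of_all _ fun x => abs_sinInt_le _)
  rw [← integral_sub (hint T) (hint δ)]
  simp_rw [im_exp_mul_charFun, ← integral_div, ← integral_sin_mul_div hδ hT]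
  refine intervalIntegral_integral_swap ?_
  have hm : AEStronglyMeasurable (fun p : ℝ × ℝ => Real.sin (p.1 * (p.2 - ξ)) / p.1)
      ((volume.restrict (Set.uIoc δ T)).prod μ) :=
    Measurable.aestronglyMeasurable (by fun_prop)
  have hfin : IsFiniteMeasure (volume.restrict (Set.uIoc δ T)) := by
    rw [Set.uIoc_of_le hT]; infer_instance
  refine (integrable_const δ⁻¹).mono' hm ?_
  rw [Set.uIoc_of_le hT]
  have hae : ∀ᵐ t ∂(volume.restrict (Set.Ioc δ T)), t ∈ Set.Ioc δ T :=
    ae_restrict_mem measurableSet_Ioc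
  filter_upwards [Measure.quasiMeasurePreserving_fst.ae hae] with p hp
  change |Real.sin (p.1 * (p.2 - ξ)) / p.1| ≤ δ⁻¹
  rw [abs_div, abs_of_pos (hδ.trans hp.1), inv_eq_one_div]
  exact div_le_div₀ zero_le_one (Real.abs_sin_le_one _) hδ hp.1.le

lemma tendsto_integral_sinInt_zero (μ : Measure ℝ) [IsFiniteMeasure μ] (ξ : ℝ) :
    Tendsto (fun δ : ℝ => ∫ x, sinInt (δ * (x - ξ)) ∂μ) (𝓝[>] 0) (𝓝 0) := by
  have h : Continuous (fun δ : ℝ => ∫ x, sinInt (δ * (x - ξ)) ∂μ) := by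
    refine continuous_of_dominated (bound := fun _ => 1 + dirichletConst)
      (fun δ => (continuous_sinInt.comp (by fun_prop)).aestronglyMeasurable)
      (fun δ => ae_of_all _ fun x => abs_sinInt_le _) (integrable_const _)
      (ae_of_all _ fun x => continuous_sinInt.comp (by fun_prop))
  have h0 := h.tendsto 0
  simp only [zero_mul, sinInt_zero, integral_zero] at h0
  exact h0.mono_left nhdsWithin_le_nhds

lemma tendsto_integral_sinInt_atTop (μ : Measure ℝ) [IsFiniteMeasure μ] (ξ : ℝ) :
    Tendsto (fun T : ℝ => ∫ x, sinInt (T * (x - ξ)) ∂μ) atTop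
      (𝓝 (dirichletConst * (μ.real (Set.Ioi ξ) - μ.real (Set.Iio ξ)))) := by
  have hlim : ∫ x, ((Set.Ioi ξ).indicator (fun _ => dirichletConst) x
      - (Set.Iio ξ).indicator (fun _ => dirichletConst) x) ∂μ
      = dirichletConst * (μ.real (Set.Ioi ξ) - μ.real (Set.Iio ξ)) := by
    rw [integral_sub ((integrable_const _).indicator measurableSet_Ioi)
      ((integrable_const _).indicator measurableSet_Iio),
      integral_indicator_const _ measurableSet_Ioi, integral_indicator_const _ measurableSet_Iio,
      smul_eq_mul, smul_eq_mul]
    ring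
  rw [← hlim]
  refine tendsto_integral_filter_of_dominated_convergence (fun _ => 1 + dirichletConst)
    (Eventually.of_forall fun T => (continuous_sinInt.comp (by fun_prop)).aestronglyMeasurable)
    (Eventually.of_forall fun T => ae_of_all _ fun x => abs_sinInt_le _) (integrable_const _)
    (ae_of_all _ fun x => ?_)
  rcases lt_trichotomy x ξ with h | rfl | h
  · have h1 : x ∉ Set.Ioi ξ := by simp [h.le]
    rw [Set.indicator_of_notMem h1, Set.indicator_of_mem (Set.mem_Iio.2 h), zero_sub]
    have h2 : Tendsto (fun T : ℝ => T * (ξ - x)) atTop atTop :=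
      tendsto_id.atTop_mul_const (by linarith)
    refine ((tendsto_sinInt.comp h2).neg).congr fun T => ?_
    rw [Function.comp_apply, ← sinInt_neg]
    congr 1
    ring
  · simp [sinInt_zero]
  · have h1 : x ∉ Set.Iio ξ := by simp [h.le]
    rw [Set.indicator_of_notMem h1, Set.indicator_of_mem (Set.mem_Ioi.2 h), sub_zero]
    exact tendsto_sinInt.comp (tendsto_id.atTop_mul_const (by linarith))

/-! ### The deconvolution function as a binomial sum -/

instance isProbabilityMeasure_convPow (ν : Measure ℝ) [IsProbabilityMeasure ν] (k : ℕ) :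
    IsProbabilityMeasure (convPow ν k) := by
  induction k with
  | zero => exact Measure.dirac.isProbabilityMeasure
  | succ k ih => rw [convPow]; infer_instance

instance isProbabilityMeasure_symmErrorLaw (με μη : Measure ℝ) [IsProbabilityMeasure με]
    [IsProbabilityMeasure μη] : IsProbabilityMeasure (symmErrorLaw με μη) := by
  have : IsProbabilityMeasure (μη.map (fun x => -x)) :=
    Measure.isProbabilityMeasure_map measurable_neg.aemeasurable
  rw [symmErrorLaw]; infer_instance

lemma charFun_convPow (ν : Measure ℝ) [IsProbabilityMeasure ν] (k : ℕ) (t : ℝ) :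
    charFun (convPow ν k) t = charFun ν t ^ k := by
  induction k with
  | zero => simp [convPow, charFun_dirac]
  | succ k ih => rw [convPow, charFun_conv, ih, pow_succ']

lemma symmObsLaw_conv_convPow (μX με μη : Measure ℝ) [IsProbabilityMeasure μX]
    [IsProbabilityMeasure με] [IsProbabilityMeasure μη] (k : ℕ) :
    symmObsLaw μX με μη ∗ convPow (symmErrorLaw με μη) k
      = μX ∗ convPow (symmErrorLaw με μη) (k + 1) := by
  have : IsProbabilityMeasure (μη.map (fun x => -x)) :=
    Measure.isProbabilityMeasure_map measurable_neg.aemeasurable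
  have h : symmObsLaw μX με μη = μX ∗ symmErrorLaw με μη := by
    rw [symmObsLaw, obsLaw, symmErrorLaw, Measure.conv_assoc]
  rw [h, convPow, Measure.conv_assoc]

lemma sum_choose_succ_mul (a : ℕ → ℝ) (l : ℕ) :
    ∑ j ∈ Finset.range (l + 2), ((l + 1).choose j : ℝ) * (-1) ^ j * a j
      = ∑ j ∈ Finset.range (l + 1), (l.choose j : ℝ) * (-1) ^ j * a j
        - ∑ k ∈ Finset.range (l + 1), (l.choose k : ℝ) * (-1) ^ k * a (k + 1) := by
  have h1 : ∑ j ∈ Finset.range (l + 1), (l.choose j : ℝ) * (-1) ^ j * a j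
      = ∑ j ∈ Finset.range (l + 2), (l.choose j : ℝ) * (-1) ^ j * a j := by
    rw [Finset.sum_range_succ _ (l + 1)]
    simp
  rw [h1, Finset.sum_range_succ', Finset.sum_range_succ' _ (l + 1), add_sub_right_comm,
    ← Finset.sum_sub_distrib]
  congr 1
  · refine Finset.sum_congr rfl fun k _ => ?_
    rw [Nat.choose_succ_succ]
    push_cast
    ring
  · simp

/-- The double sum defining the deconvolution function telescopes. In terms of measures,
`∑_{l ≤ m} (δ₀ - ν)^{*l} * ν = δ₀ - (δ₀ - ν)^{*(m+1)}`. -/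
lemma decFun_eq (μX με μη : Measure ℝ) [IsProbabilityMeasure μX]
    [IsProbabilityMeasure με] [IsProbabilityMeasure μη] (ξ : ℝ) (m : ℕ) :
    decFun μX με μη ξ m = cdf μX ξ - ∑ j ∈ Finset.range (m + 2), ((m + 1).choose j : ℝ) * (-1) ^ j *
      cdf (μX ∗ convPow (symmErrorLaw με μη) j) ξ := by
  simp only [decFun, symmObsLaw_conv_convPow]
  induction m with
  | zero =>
    simp [Finset.sum_range_succ, convPow, Measure.conv_dirac_zero]
  | succ m ih =>
    rw [Finset.sum_range_succ, ih,
      sum_choose_succ_mul (fun j => cdf (μX ∗ convPow (symmErrorLaw με μη) j) ξ) (m + 1)]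
    ring

lemma one_sub_pow_eq_sum (p : ℝ) (n : ℕ) :
    (1 - p) ^ n = ∑ j ∈ Finset.range (n + 1), (n.choose j : ℝ) * (-1) ^ j * p ^ j := by
  rw [sub_eq_neg_add, add_pow]
  refine Finset.sum_congr rfl fun j _ => ?_
  rw [neg_pow p j, one_pow]
  ring

/-! ### The deconvolution error as an inversion integral -/

lemma measureReal_Ioi_sub_Iio (μ : Measure ℝ) [IsProbabilityMeasure μ] (ξ : ℝ) :
    μ.real (Set.Ioi ξ) - μ.real (Set.Iio ξ)
      = 1 - cdf μ ξ - Function.leftLim (cdf μ) ξ := by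
  have h1 : μ.real (Set.Ioi ξ) = 1 - cdf μ ξ := by
    rw [cdf_eq_real, ← Set.compl_Iic, probReal_compl_eq_one_sub measurableSet_Iic]
  have h2 : μ.real (Set.Iio ξ) = Function.leftLim (cdf μ) ξ := by
    have h := (cdf μ).measure_Iio (tendsto_cdf_atBot μ) ξ
    rw [measure_cdf, sub_zero] at h
    rw [measureReal_def, h, ENNReal.toReal_ofReal]
    exact (cdf_nonneg μ (ξ - 1)).trans ((monotone_cdf μ).le_leftLim (by linarith))
  rw [h1, h2]

lemma leftLim_cdf_eq_of_mem_decContinuity {μX με μη : Measure ℝ} {ξ : ℝ}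
    (hξ : ξ ∈ decContinuity μX με μη) {j : ℕ} (hj : 1 ≤ j) :
    Function.leftLim (cdf (μX ∗ convPow (symmErrorLaw με μη) j)) ξ
      = cdf (μX ∗ convPow (symmErrorLaw με μη) j) ξ := by
  have h : ¬ 0 < jump (cdf (μX ∗ convPow (symmErrorLaw με μη) j)) ξ :=
    fun h => hξ ⟨j, hj, h⟩
  rw [jump, StieltjesFunction.rightLim_eq] at h
  refine le_antisymm ((monotone_cdf _).leftLim_le le_rfl) ?_
  linarith

/-- The integrand of the inversion formula for the signed measure `μX * (δ₀ - ν)^{*(m+1)}`. -/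
def errIntegrand (μX ν : Measure ℝ) (ξ : ℝ) (m : ℕ) (t : ℝ) : ℝ :=
  (Complex.exp (-(t * ξ : ℝ) * Complex.I) * charFun μX t).im * (mPower ν t m / t)

section

variable {μX ν : Measure ℝ}

lemma measurable_errIntegrand [IsProbabilityMeasure μX] [IsProbabilityMeasure ν] (ξ : ℝ) (m : ℕ) :
    Measurable (errIntegrand μX ν ξ m) := by
  have h1 : Measurable (charFun μX) := measurable_charFun
  have h2 : Measurable (charFun ν) := measurable_charFun
  unfold errIntegrand mPower
  fun_prop

lemma measurable_mPower [IsProbabilityMeasure ν] (m : ℕ) : Measurable (fun t => mPower ν t m) := by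
  have h2 : Measurable (charFun ν) := measurable_charFun
  unfold mPower
  fun_prop

lemma mPower_nonneg (hp : ∀ t, (charFun ν t).re ∈ Set.Icc (0 : ℝ) 1) (t : ℝ) (m : ℕ) :
    0 ≤ mPower ν t m :=
  pow_nonneg (by linarith [(hp t).2]) _

lemma mPower_le_one (hp : ∀ t, (charFun ν t).re ∈ Set.Icc (0 : ℝ) 1) (t : ℝ) (m : ℕ) :
    mPower ν t m ≤ 1 :=
  pow_le_one₀ (by linarith [(hp t).2]) (by linarith [(hp t).1])

lemma mPower_le_mPower_zero (hp : ∀ t, (charFun ν t).re ∈ Set.Icc (0 : ℝ) 1) (t : ℝ) (m : ℕ) :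
    mPower ν t m ≤ mPower ν t 0 :=
  pow_le_pow_of_le_one (by linarith [(hp t).2]) (by linarith [(hp t).1]) (by omega)

/-- Away from the origin `mPower ν t 0 / t` is bounded, so that the integrability condition at the
origin extends to every bounded interval. -/
lemma integrableOn_mPower_zero_div [IsProbabilityMeasure ν]
    (hp : ∀ t, (charFun ν t).re ∈ Set.Icc (0 : ℝ) 1)
    (hint : IntegrableNearZero ν) (T : ℝ) :
    IntegrableOn (fun t : ℝ => mPower ν t 0 / t) (Set.Ioc 0 T) := by
  obtain ⟨τ, hτ, h⟩ := hint
  have h2 : IntegrableOn (fun t : ℝ => mPower ν t 0 / t) (Set.Ioc τ T) := by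
    refine (integrable_const τ⁻¹).mono'
      ((measurable_mPower 0).div measurable_id).aestronglyMeasurable ?_
    filter_upwards [ae_restrict_mem measurableSet_Ioc] with t ht
    have ht0 := hτ.trans ht.1
    rw [Real.norm_of_nonneg (div_nonneg (mPower_nonneg hp t 0) ht0.le), inv_eq_one_div]
    exact div_le_div₀ zero_le_one (mPower_le_one hp t 0) hτ ht.1.le
  refine (h.union h2).mono_set fun t ht => ?_
  rcases le_or_gt t τ with h | h
  · exact Or.inl ⟨ht.1, h⟩
  · exact Or.inr ⟨h, ht.2⟩

lemma norm_errIntegrand_le [IsProbabilityMeasure μX]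
    (hp : ∀ t, (charFun ν t).re ∈ Set.Icc (0 : ℝ) 1) (ξ : ℝ) (m : ℕ) {t : ℝ} (ht : 0 < t) :
    ‖errIntegrand μX ν ξ m t‖ ≤ mPower ν t m / t := by
  rw [errIntegrand, norm_mul,
    Real.norm_of_nonneg (div_nonneg (mPower_nonneg hp t m) ht.le)]
  refine mul_le_of_le_one_left (div_nonneg (mPower_nonneg hp t m) ht.le) ?_
  refine (Complex.abs_im_le_norm _).trans ?_
  rw [norm_mul, ← Complex.ofReal_neg, Complex.norm_exp_ofReal_mul_I, one_mul]
  exact norm_charFun_le_one t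

lemma norm_errIntegrand_le_zero [IsProbabilityMeasure μX]
    (hp : ∀ t, (charFun ν t).re ∈ Set.Icc (0 : ℝ) 1) (ξ : ℝ) (m : ℕ) {t : ℝ} (ht : 0 < t) :
    ‖errIntegrand μX ν ξ m t‖ ≤ mPower ν t 0 / t :=
  (norm_errIntegrand_le hp ξ m ht).trans <| by gcongr; exact mPower_le_mPower_zero hp t m

lemma integrableOn_errIntegrand [IsProbabilityMeasure μX] [IsProbabilityMeasure ν]
    (hp : ∀ t, (charFun ν t).re ∈ Set.Icc (0 : ℝ) 1)
    (hint : IntegrableNearZero ν) (ξ : ℝ) (m : ℕ) (T : ℝ) :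
    IntegrableOn (errIntegrand μX ν ξ m) (Set.Ioc 0 T) := by
  refine (integrableOn_mPower_zero_div hp hint T).mono'
    (measurable_errIntegrand ξ m).aestronglyMeasurable ?_
  filter_upwards [ae_restrict_mem measurableSet_Ioc] with t ht
  exact norm_errIntegrand_le_zero hp ξ m ht.1

lemma errIntegrand_eq_sum [IsProbabilityMeasure μX] [IsProbabilityMeasure ν]
    (him : ∀ t, (charFun ν t).im = 0) (ξ : ℝ) (m : ℕ) (t : ℝ) :
    errIntegrand μX ν ξ m t = ∑ j ∈ Finset.range (m + 2), ((m + 1).choose j : ℝ) * (-1) ^ j *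
      ((Complex.exp (-(t * ξ : ℝ) * Complex.I) * charFun (μX ∗ convPow ν j) t).im / t) := by
  have hre : charFun ν t = ((charFun ν t).re : ℂ) := by
    apply Complex.ext <;> simp [him]
  have hj : ∀ j : ℕ, (Complex.exp (-(t * ξ : ℝ) * Complex.I) * charFun (μX ∗ convPow ν j) t).im
      = (Complex.exp (-(t * ξ : ℝ) * Complex.I) * charFun μX t).im * (charFun ν t).re ^ j := by
    intro j
    rw [charFun_conv, charFun_convPow, hre, ← mul_assoc, ← Complex.ofReal_pow,
      Complex.im_mul_ofReal, Complex.ofReal_re]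
  simp only [hj, errIntegrand, mPower, one_sub_pow_eq_sum, Finset.sum_div, Finset.mul_sum]
  refine Finset.sum_congr rfl fun j _ => ?_
  ring

lemma integral_errIntegrand [IsProbabilityMeasure μX] [IsProbabilityMeasure ν]
    (him : ∀ t, (charFun ν t).im = 0)
    (hp : ∀ t, (charFun ν t).re ∈ Set.Icc (0 : ℝ) 1)
    (hint : IntegrableNearZero ν) (ξ : ℝ) (m : ℕ) {T : ℝ} (hT : 0 < T) :
    ∫ t in (0 : ℝ)..T, errIntegrand μX ν ξ m t
      = ∑ j ∈ Finset.range (m + 2), ((m + 1).choose j : ℝ) * (-1) ^ j *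
        ∫ x, sinInt (T * (x - ξ)) ∂(μX ∗ convPow ν j) := by
  have hii : ∀ a ∈ Set.Icc 0 T, ∀ b ∈ Set.Icc 0 T,
      IntervalIntegrable (errIntegrand μX ν ξ m) volume a b := by
    intro a ha b hb
    refine (intervalIntegrable_iff.2 ((integrableOn_errIntegrand hp hint ξ m T).mono_set ?_))
    rw [Set.uIoc]
    exact Set.Ioc_subset_Ioc (le_min ha.1 hb.1) (max_le ha.2 hb.2)
  -- the integral over `[δ, T]`, before the passage to the limit `δ → 0`
  have hδ : ∀ δ ∈ Set.Ioc 0 T, ∫ t in δ..T, errIntegrand μX ν ξ m t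
      = ∑ j ∈ Finset.range (m + 2), ((m + 1).choose j : ℝ) * (-1) ^ j *
        (∫ x, sinInt (T * (x - ξ)) ∂(μX ∗ convPow ν j)
          - ∫ x, sinInt (δ * (x - ξ)) ∂(μX ∗ convPow ν j)) := by
    intro δ hδ
    simp only [errIntegrand_eq_sum him]
    rw [intervalIntegral.integral_finsetSum]
    · refine Finset.sum_congr rfl fun j _ => ?_
      rw [intervalIntegral.integral_const_mul, integral_im_exp_mul_charFun_div _ ξ hδ.1 hδ.2]
    · intro j _
      refine IntervalIntegrable.const_mul ?_ _
      refine ContinuousOn.intervalIntegrable fun t ht => ?_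
      rw [Set.uIcc_of_le hδ.2] at ht
      have ht0 : t ≠ 0 := (hδ.1.trans_le ht.1).ne'
      refine ContinuousAt.continuousWithinAt (ContinuousAt.div ?_ continuousAt_id ht0)
      have hc : Continuous (charFun (μX ∗ convPow ν j)) := continuous_charFun
      exact Continuous.continuousAt (by fun_prop)
  have hlim1 : Tendsto (fun δ => ∫ t in δ..T, errIntegrand μX ν ξ m t) (𝓝[>] 0)
      (𝓝 (∫ t in (0 : ℝ)..T, errIntegrand μX ν ξ m t)) := by
    have hc := intervalIntegral.continuousOn_primitive_interval
      (f := errIntegrand μX ν ξ m) (μ := volume) (a := 0) (b := T)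
      (by rw [Set.uIcc_of_le hT.le, integrableOn_Icc_iff_integrableOn_Ioc]
          exact integrableOn_errIntegrand hp hint ξ m T)
    rw [Set.uIcc_of_le hT.le] at hc
    have h0 := (hc 0 ⟨le_rfl, hT.le⟩).tendsto
    simp only [intervalIntegral.integral_same] at h0
    have h1 := (h0.mono_left (nhdsWithin_mono 0 Set.Ioc_subset_Icc_self)).const_sub
      (∫ t in (0 : ℝ)..T, errIntegrand μX ν ξ m t)
    rw [sub_zero, nhdsWithin_Ioc_eq_nhdsGT hT] at h1
    refine h1.congr' ?_
    filter_upwards [Ioc_mem_nhdsGT hT] with δ hd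
    rw [intervalIntegral.integral_interval_sub_left (hii _ ⟨le_rfl, hT.le⟩ _ ⟨hT.le, le_rfl⟩)
      (hii _ ⟨le_rfl, hT.le⟩ _ ⟨hd.1.le, hd.2⟩)]
  have hlim2 : Tendsto (fun δ => ∑ j ∈ Finset.range (m + 2), ((m + 1).choose j : ℝ) * (-1) ^ j *
        (∫ x, sinInt (T * (x - ξ)) ∂(μX ∗ convPow ν j)
          - ∫ x, sinInt (δ * (x - ξ)) ∂(μX ∗ convPow ν j))) (𝓝[>] 0)
      (𝓝 (∑ j ∈ Finset.range (m + 2), ((m + 1).choose j : ℝ) * (-1) ^ j *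
        (∫ x, sinInt (T * (x - ξ)) ∂(μX ∗ convPow ν j) - 0))) :=
    tendsto_finsetSum _ fun j _ =>
      ((tendsto_integral_sinInt_zero (μX ∗ convPow ν j) ξ).const_sub _).const_mul _
  simp only [sub_zero] at hlim2
  refine tendsto_nhds_unique hlim1 (hlim2.congr' ?_)
  filter_upwards [Ioc_mem_nhdsGT hT] with δ hd
  exact (hδ δ hd).symm

end

/-- The deviation of `𝔇(ξ, m)` from the midpoint of the jump of `F_X` at `ξ` is, up to a positive
constant, an improper inversion integral. All convolutions with at least one error factor are
continuous at `ξ`, so that only the term without error contributes a left limit of its own. -/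
lemma tendsto_integral_errIntegrand {μX με μη : Measure ℝ} [IsProbabilityMeasure μX]
    [IsProbabilityMeasure με] [IsProbabilityMeasure μη]
    (hη : Symmetrizes μη με) (hint : IntegrableNearZero (symmErrorLaw με μη))
    {ξ : ℝ} (hξ : ξ ∈ decContinuity μX με μη) (m : ℕ) :
    Tendsto (fun T => ∫ t in (0 : ℝ)..T, errIntegrand μX (symmErrorLaw με μη) ξ m t) atTop
      (𝓝 (2 * dirichletConst *
        (decFun μX με μη ξ m - (cdf μX ξ + Function.leftLim (cdf μX) ξ) / 2))) := by
  set ν := symmErrorLaw με μη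
  have hlim : Tendsto (fun T => ∑ j ∈ Finset.range (m + 2), ((m + 1).choose j : ℝ) * (-1) ^ j *
        ∫ x, sinInt (T * (x - ξ)) ∂(μX ∗ convPow ν j)) atTop
      (𝓝 (∑ j ∈ Finset.range (m + 2), ((m + 1).choose j : ℝ) * (-1) ^ j *
        (dirichletConst * (1 - cdf (μX ∗ convPow ν j) ξ
          - Function.leftLim (cdf (μX ∗ convPow ν j)) ξ)))) := by
    refine tendsto_finsetSum _ fun j _ => Tendsto.const_mul _ ?_
    rw [← measureReal_Ioi_sub_Iio]
    exact tendsto_integral_sinInt_atTop _ ξ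
  have hval : ∑ j ∈ Finset.range (m + 2), ((m + 1).choose j : ℝ) * (-1) ^ j *
        (dirichletConst * (1 - cdf (μX ∗ convPow ν j) ξ
          - Function.leftLim (cdf (μX ∗ convPow ν j)) ξ))
      = 2 * dirichletConst *
        (decFun μX με μη ξ m - (cdf μX ξ + Function.leftLim (cdf μX) ξ) / 2) := by
    have hzero := one_sub_pow_eq_sum 1 (m + 1)
    simp only [sub_self, one_pow, mul_one, ne_eq, Nat.add_eq_zero_iff, one_ne_zero, and_false,
      not_false_eq_true, zero_pow] at hzero
    have h0 : μX ∗ convPow ν 0 = μX := by rw [convPow, Measure.conv_dirac_zero]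
    have hsplit : ∀ j ∈ Finset.range (m + 2), ((m + 1).choose j : ℝ) * (-1) ^ j *
        (dirichletConst * (1 - cdf (μX ∗ convPow ν j) ξ
          - Function.leftLim (cdf (μX ∗ convPow ν j)) ξ))
        = dirichletConst * (((m + 1).choose j : ℝ) * (-1) ^ j)
          - 2 * dirichletConst * (((m + 1).choose j : ℝ) * (-1) ^ j * cdf (μX ∗ convPow ν j) ξ)
          + if j = 0 then dirichletConst * (cdf μX ξ - Function.leftLim (cdf μX) ξ) else 0 := by
      intro j _
      split_ifs with hj
      · subst hj
        rw [h0]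
        simp only [Nat.choose_zero_right, Nat.cast_one, pow_zero]
        ring
      · rw [leftLim_cdf_eq_of_mem_decContinuity hξ (Nat.one_le_iff_ne_zero.2 hj)]
        ring
    rw [Finset.sum_congr rfl hsplit, Finset.sum_add_distrib, Finset.sum_sub_distrib,
      ← Finset.mul_sum, ← Finset.mul_sum, ← hzero, Finset.sum_ite_eq' (Finset.range (m + 2)) 0,
      if_pos (by simp), decFun_eq]
    ring
  rw [← hval]
  refine hlim.congr' ?_
  filter_upwards [eventually_gt_atTop 0] with T hT
  exact (integral_errIntegrand hη.real_valued hη.mem_Icc hint ξ m hT).symm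

/-! ### Summation by parts along arithmetic progressions -/

lemma one_sub_mul_sum_pow_mul (z : ℂ) (a : ℕ → ℂ) (N : ℕ) :
    (1 - z) * ∑ j ∈ Finset.range N, z ^ j * a j
      = a 0 - z ^ N * a N + ∑ j ∈ Finset.range N, z ^ (j + 1) * (a (j + 1) - a j) := by
  induction N with
  | zero => simp
  | succ N ih =>
    rw [Finset.sum_range_succ, Finset.sum_range_succ, mul_add, ih]
    ring

lemma norm_one_sub_mul_norm_sum_le {z : ℂ} (hz : ‖z‖ = 1) (a : ℕ → ℂ) (N : ℕ) :
    ‖1 - z‖ * ‖∑ j ∈ Finset.range N, z ^ j * a j‖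
      ≤ ‖a 0‖ + ‖a N‖ + ∑ j ∈ Finset.range N, ‖a (j + 1) - a j‖ := by
  rw [← norm_mul, one_sub_mul_sum_pow_mul]
  refine (norm_add_le _ _).trans (add_le_add ((norm_sub_le _ _).trans ?_) ?_)
  · simp [hz]
  · refine (norm_sum_le _ _).trans (Finset.sum_le_sum fun j _ => ?_)
    simp [hz]

lemma sum_norm_sub_le_of_eVariationOn_le {ψ : ℝ → ℂ} {s : Set ℝ} {V : ℝ} (hV : 0 ≤ V)
    (hvar : eVariationOn ψ s ≤ ENNReal.ofReal V) {u : ℕ → ℝ} (hu : Monotone u)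
    (hus : ∀ j, u j ∈ s) (N : ℕ) :
    ∑ j ∈ Finset.range N, ‖ψ (u (j + 1)) - ψ (u j)‖ ≤ V := by
  have h := (eVariationOn.sum_le (f := ψ) (n := N) hu hus).trans hvar
  have he : ∑ j ∈ Finset.range N, edist (ψ (u (j + 1))) (ψ (u j))
      = ENNReal.ofReal (∑ j ∈ Finset.range N, ‖ψ (u (j + 1)) - ψ (u j)‖) := by
    rw [ENNReal.ofReal_sum_of_nonneg fun j _ => norm_nonneg _]
    exact Finset.sum_congr rfl fun j _ => by rw [edist_dist, dist_eq_norm]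
  rw [he] at h
  exact (ENNReal.ofReal_le_ofReal_iff hV).1 h

lemma sum_abs_sub_le_one {q : ℕ → ℝ} (hq : Monotone q ∨ Antitone q)
    (hq01 : ∀ j, q j ∈ Set.Icc (0 : ℝ) 1) (N : ℕ) :
    ∑ j ∈ Finset.range N, |q (j + 1) - q j| ≤ 1 := by
  rcases hq with hq | hq
  · rw [Finset.sum_congr rfl fun j _ => abs_of_nonneg (sub_nonneg.2 (hq (Nat.le_succ j))),
      Finset.sum_range_sub]
    linarith [(hq01 N).2, (hq01 0).1]
  · rw [Finset.sum_congr rfl fun j _ => (abs_sub_comm _ _).trans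
      (abs_of_nonneg (sub_nonneg.2 (hq (Nat.le_succ j)))), Finset.sum_range_sub']
    linarith [(hq01 0).2, (hq01 N).1]

/-- An exponential sum whose coefficients are the product of a function of small variation and a
monotone sequence in `[0, 1]` is small, as long as its frequency stays away from `2πℤ`. -/
lemma norm_one_sub_mul_norm_sum_mul_le {z : ℂ} (hz : ‖z‖ = 1) {ψ : ℝ → ℂ} {s : Set ℝ} {V : ℝ}
    (hvar : eVariationOn ψ s ≤ ENNReal.ofReal V) (hsup : ∀ t ∈ s, ‖ψ t‖ ≤ V)
    {u : ℕ → ℝ} (hu : Monotone u) (hus : ∀ j, u j ∈ s)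
    {q : ℕ → ℝ} (hq : Monotone q ∨ Antitone q) (hq01 : ∀ j, q j ∈ Set.Icc (0 : ℝ) 1) (N : ℕ) :
    ‖1 - z‖ * ‖∑ j ∈ Finset.range N, z ^ j * (ψ (u j) * q j)‖ ≤ 4 * V := by
  have hV : 0 ≤ V := (norm_nonneg _).trans (hsup _ (hus 0))
  have hnq : ∀ j, ‖(q j : ℂ)‖ ≤ 1 := fun j => by
    rw [Complex.norm_real, Real.norm_of_nonneg (hq01 j).1]
    exact (hq01 j).2
  have hterm : ∀ j, ‖ψ (u j) * q j‖ ≤ V := fun j => by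
    rw [norm_mul]
    exact (mul_le_of_le_one_right (norm_nonneg _) (hnq j)).trans (hsup _ (hus j))
  have hdiff : ∀ j, ‖ψ (u (j + 1)) * q (j + 1) - ψ (u j) * q j‖
      ≤ ‖ψ (u (j + 1)) - ψ (u j)‖ + V * |q (j + 1) - q j| := fun j => by
    have hsplit : ψ (u (j + 1)) * q (j + 1) - ψ (u j) * q j
        = (ψ (u (j + 1)) - ψ (u j)) * q (j + 1) + ψ (u j) * ((q (j + 1) - q j : ℝ) : ℂ) := by
      push_cast
      ring
    rw [hsplit]
    refine (norm_add_le _ _).trans (add_le_add ?_ ?_)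
    · rw [norm_mul]
      exact mul_le_of_le_one_right (norm_nonneg _) (hnq _)
    · rw [norm_mul, Complex.norm_real, Real.norm_eq_abs]
      exact mul_le_mul_of_nonneg_right (hsup _ (hus j)) (abs_nonneg _)
  refine (norm_one_sub_mul_norm_sum_le hz (fun j => ψ (u j) * q j) N).trans ?_
  have h1 : ∑ j ∈ Finset.range N, ‖ψ (u (j + 1)) * q (j + 1) - ψ (u j) * q j‖ ≤ V + V * 1 := by
    refine (Finset.sum_le_sum fun j _ => hdiff j).trans ?_
    rw [Finset.sum_add_distrib, ← Finset.mul_sum]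
    exact add_le_add (sum_norm_sub_le_of_eVariationOn_le hV hvar hu hus N)
      (mul_le_mul_of_nonneg_left (sum_abs_sub_le_one hq hq01 N) hV)
  linarith [hterm 0, hterm N]

/-- Cutting `[A, A + Nρ]` into `N` intervals of length `ρ` turns an oscillatory integral into the
integral over `[0, ρ]` of exponential sums along arithmetic progressions of step `ρ`. -/
lemma norm_integral_exp_mul_le {A ρ V κ θ : ℝ} (hρ : 0 < ρ) (hκ : 0 < κ)
    (hθ : κ ≤ ‖1 - Complex.exp ((ρ * θ : ℝ) * Complex.I)‖)
    {ψ : ℝ → ℂ} (hψ : ContinuousOn ψ (Set.Ici A))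
    (hvar : eVariationOn ψ (Set.Ici A) ≤ ENNReal.ofReal V) (hsup : ∀ t ∈ Set.Ici A, ‖ψ t‖ ≤ V)
    {P : ℝ → ℝ} (hP : Continuous P) (hP01 : ∀ t, P t ∈ Set.Icc (0 : ℝ) 1)
    (hmono : ∀ s ∈ Set.Icc 0 ρ, Monotone (fun j : ℕ => P (A + s + j * ρ)) ∨
      Antitone (fun j : ℕ => P (A + s + j * ρ))) (N : ℕ) :
    ‖∫ t in A..(A + N * ρ), Complex.exp ((t * θ : ℝ) * Complex.I) * (ψ t * P t)‖
      ≤ 4 * V / κ * ρ := by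
  set f : ℝ → ℂ := fun t => Complex.exp ((t * θ : ℝ) * Complex.I) * (ψ t * P t) with hf
  have hfc : ContinuousOn f (Set.Ici A) := by
    have h1 : Continuous (fun t : ℝ => Complex.exp ((t * θ : ℝ) * Complex.I)) := by fun_prop
    have h2 : Continuous (fun t : ℝ => (P t : ℂ)) := by fun_prop
    exact h1.continuousOn.mul (hψ.mul h2.continuousOn)
  have hshift : ∀ j : ℕ, Set.MapsTo (fun s : ℝ => A + s + j * ρ) (Set.uIcc 0 ρ) (Set.Ici A) := by
    intro j s hs
    rw [Set.uIcc_of_le hρ.le] at hs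
    have : 0 ≤ (j : ℝ) * ρ := by positivity
    simp only [Set.mem_Ici]
    linarith [hs.1]
  have hsum : ∫ t in A..(A + N * ρ), f t
      = ∫ s in (0 : ℝ)..ρ, ∑ j ∈ Finset.range N, f (A + s + j * ρ) := by
    have h1 := intervalIntegral.sum_integral_adjacent_intervals (f := f) (μ := volume)
      (a := fun j : ℕ => A + j * ρ) (n := N) (fun j _ => by
        refine (hfc.mono fun t ht => ?_).intervalIntegrable
        rw [Set.uIcc_of_le (by gcongr; linarith)] at ht
        have : 0 ≤ (j : ℝ) * ρ := by positivity
        exact le_trans (by linarith) ht.1)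
    simp only [Nat.cast_zero, zero_mul, add_zero] at h1
    have h3 : ∫ s in (0 : ℝ)..ρ, ∑ j ∈ Finset.range N, f (A + s + j * ρ)
        = ∑ j ∈ Finset.range N, ∫ s in (0 : ℝ)..ρ, f (A + s + j * ρ) :=
      intervalIntegral.integral_finsetSum fun j _ =>
        (hfc.comp (by fun_prop) (hshift j)).intervalIntegrable
    rw [← h1, h3]
    refine Finset.sum_congr rfl fun j _ => ?_
    have h2 := intervalIntegral.integral_comp_add_left (a := 0) (b := ρ) f (A + j * ρ)
    rw [add_zero] at h2
    rw [show A + ((j + 1 : ℕ) : ℝ) * ρ = A + j * ρ + ρ by push_cast; ring, ← h2]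
    refine intervalIntegral.integral_congr fun s _ => ?_
    exact congrArg f (by ring)
  have hbound : ∀ s ∈ Set.uIoc 0 ρ, ‖∑ j ∈ Finset.range N, f (A + s + j * ρ)‖ ≤ 4 * V / κ := by
    intro s hs
    rw [Set.uIoc_of_le hρ.le] at hs
    set z := Complex.exp ((ρ * θ : ℝ) * Complex.I) with hz
    have hfz : ∑ j ∈ Finset.range N, f (A + s + j * ρ)
        = Complex.exp (((A + s) * θ : ℝ) * Complex.I) *
          ∑ j ∈ Finset.range N, z ^ j * (ψ (A + s + j * ρ) * (P (A + s + j * ρ) : ℝ)) := by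
      rw [Finset.mul_sum]
      refine Finset.sum_congr rfl fun j _ => ?_
      simp only [hf, hz]
      rw [← Complex.exp_nat_mul, ← mul_assoc (Complex.exp (((A + s) * θ : ℝ) * Complex.I)),
        ← Complex.exp_add]
      congr 2
      push_cast
      ring
    rw [hfz, norm_mul, Complex.norm_exp_ofReal_mul_I, one_mul, le_div_iff₀ hκ, mul_comm]
    refine (mul_le_mul_of_nonneg_right hθ (norm_nonneg _)).trans ?_
    refine norm_one_sub_mul_norm_sum_mul_le (Complex.norm_exp_ofReal_mul_I _) hvar hsup
      (u := fun j : ℕ => A + s + j * ρ) ?_ (fun j => hshift j ?_)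
      (q := fun j : ℕ => P (A + s + j * ρ)) (hmono s ⟨hs.1.le, hs.2⟩) (fun j => hP01 _) N
    · intro i j hij
      simp only
      gcongr
    · rw [Set.uIcc_of_le hρ.le]
      exact ⟨hs.1.le, hs.2⟩
  rw [hsum]
  refine (intervalIntegral.norm_integral_le_of_norm_le_const hbound).trans_eq ?_
  rw [sub_zero, abs_of_pos hρ]

/-- Frequencies at distance at least `d` from `2πℤ` have exponentials bounded away from `1`. -/
lemma le_norm_one_sub_exp {d α : ℝ} (hα : ∀ k : ℤ, d ≤ |α - 2 * Real.pi * k|) :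
    2 / Real.pi * d ≤ ‖1 - Complex.exp ((α : ℝ) * Complex.I)‖ := by
  have hpi := Real.pi_pos
  set k : ℤ := round (α / (2 * Real.pi)) with hk
  set β := α - 2 * Real.pi * k with hβ
  have hβle : |β / 2| ≤ Real.pi / 2 := by
    have h := abs_sub_round (α / (2 * Real.pi))
    rw [← hk] at h
    have h2 : β / 2 = Real.pi * (α / (2 * Real.pi) - k) := by
      rw [hβ]
      field_simp
    rw [h2, abs_mul, abs_of_pos hpi]
    nlinarith
  have hexp : Complex.exp ((α : ℝ) * Complex.I) = Complex.exp (Complex.I * (β : ℝ)) := by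
    rw [Complex.exp_eq_exp_iff_exists_int]
    refine ⟨k, ?_⟩
    rw [hβ]
    push_cast
    ring
  rw [hexp, norm_sub_rev, Complex.norm_exp_I_mul_ofReal_sub_one, Real.norm_eq_abs, abs_mul,
    abs_of_pos (zero_lt_two' ℝ)]
  have h1 := Real.mul_abs_le_abs_sin hβle
  have h2 := hα k
  rw [← hβ] at h2
  rw [abs_div, abs_of_pos (zero_lt_two' ℝ)] at h1
  calc 2 / Real.pi * d ≤ 2 / Real.pi * |β| := by gcongr
    _ = 2 * (2 / Real.pi * (|β| / 2)) := by ring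
    _ ≤ 2 * |Real.sin (β / 2)| := by gcongr

lemma exists_pos_le_norm_one_sub_exp {D : Set ℝ} {ρ ξ : ℝ}
    (hdist : 0 < setDist ((fun x : ℝ => (x - ξ) * ρ) '' D) twoPiInt) :
    ∃ κ : ℝ, 0 < κ ∧ ∀ x ∈ D,
      κ ≤ ‖1 - Complex.exp ((ρ * (x - ξ) : ℝ) * Complex.I)‖ := by
  obtain ⟨d, hd0, hd⟩ := ENNReal.lt_iff_exists_real_btwn.1 hdist
  have hd1 : 0 < d := by simpa using hd.1
  refine ⟨2 / Real.pi * d, by positivity, fun x hx => le_norm_one_sub_exp fun k => ?_⟩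
  have h : setDist ((fun x : ℝ => (x - ξ) * ρ) '' D) twoPiInt
      ≤ edist ((x - ξ) * ρ) (2 * Real.pi * (k : ℝ)) :=
    (iInf₂_le _ (Set.mem_image_of_mem _ hx)).trans (iInf₂_le _ (Set.mem_range_self k))
  have h2 := hd.2.le.trans h
  rw [edist_dist, ENNReal.ofReal_le_ofReal_iff dist_nonneg, Real.dist_eq] at h2
  rwa [mul_comm ρ]

/-! ### Purely atomic complex measures -/

lemma countable_atoms (G : ComplexMeasure ℝ) (hfin : G.variation Set.univ < ∞) :
    (atoms G).Countable := by
  have : IsFiniteMeasure G.variation := ⟨hfin⟩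
  refine (Measure.countable_meas_pos_of_disjoint_iUnion (μ := G.variation)
    (As := fun x : ℝ => {x}) (fun x => measurableSet_singleton x) ?_).mono fun x hx => ?_
  · intro x y hxy
    simpa [Function.onFun] using hxy
  · refine lt_of_lt_of_le ?_ (G.enorm_measure_le_variation {x})
    simpa [atoms] using hx

/-- The transform of a purely atomic measure is a uniform limit of finite exponential sums over
its atoms. -/
lemma exists_finset_fourierStieltjes (G : ComplexMeasure ℝ) (hfin : G.variation Set.univ < ∞)
    (hat : G.variation Set.univ = G.variation (atoms G)) {η : ℝ} (hη : 0 < η) :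
    ∃ S : Finset ℝ, (∀ x ∈ S, x ∈ atoms G) ∧
      (∑ x ∈ S, ‖G {x}‖ ≤ G.variation.real Set.univ) ∧
      ∀ t : ℝ, ‖fourierStieltjes G t
        - ∑ x ∈ S, Complex.exp (Complex.I * (t : ℂ) * (x : ℂ)) * G {x}‖ ≤ η := by
  classical
  have hfm : IsFiniteMeasure G.variation := ⟨hfin⟩
  obtain ⟨S, hS, hSη⟩ : ∃ S : Finset ℝ, (∀ x ∈ S, x ∈ atoms G) ∧
      G.variation.real (↑S : Set ℝ)ᶜ ≤ η := by
    rcases (atoms G).eq_empty_or_nonempty with he | hne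
    · refine ⟨∅, by simp, ?_⟩
      rw [he, measure_empty] at hat
      simp [measureReal_def, hat, hη.le]
    · obtain ⟨f, hf⟩ := (countable_atoms G hfin).exists_eq_range hne
      have hm : Monotone (fun n => (↑((Finset.range n).image f) : Set ℝ)) := fun i j hij =>
        Finset.coe_subset.2 (Finset.image_subset_image (Finset.range_mono hij))
      have hU : ⋃ n, (↑((Finset.range n).image f) : Set ℝ) = atoms G := by
        rw [hf]
        ext x
        simp only [Set.mem_iUnion, Finset.coe_image, Set.mem_image, Finset.coe_range, Set.mem_Iio,
          Set.mem_range]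
        exact ⟨fun ⟨_, i, _, h⟩ => ⟨i, h⟩, fun ⟨i, h⟩ => ⟨i + 1, i, Nat.lt_succ_self i, h⟩⟩
      have ht := tendsto_measure_iUnion_atTop (μ := G.variation) hm
      rw [hU, ← hat] at ht
      have ht2 := (ENNReal.tendsto_toReal hfin.ne).comp ht
      obtain ⟨n, hn⟩ := (ht2.eventually (lt_mem_nhds (sub_lt_self _ hη))).exists
      refine ⟨(Finset.range n).image f, fun x hx => ?_, ?_⟩
      · rw [hf]
        obtain ⟨i, _, rfl⟩ := Finset.mem_image.1 hx
        exact Set.mem_range_self i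
      · rw [measureReal_compl (Finset.measurableSet _)]
        simp only [Function.comp_apply] at hn
        simp only [measureReal_def]
        linarith
  refine ⟨S, hS, ?_, fun t => ?_⟩
  · calc ∑ x ∈ S, ‖G {x}‖ ≤ ∑ x ∈ S, G.variation.real {x} :=
          Finset.sum_le_sum fun x _ => VectorMeasure.norm_measure_le_variation
      _ = G.variation.real S := by simp
      _ ≤ G.variation.real Set.univ := measureReal_mono (Set.subset_univ _)
  · have hnorm : ∀ x : ℝ, ‖Complex.exp (Complex.I * (t : ℂ) * (x : ℂ))‖ = 1 := fun x => by
      rw [show Complex.I * (t : ℂ) * (x : ℂ) = ((t * x : ℝ) : ℂ) * Complex.I by push_cast; ring,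
        Complex.norm_exp_ofReal_mul_I]
    have hi : G.Integrable (fun x : ℝ => Complex.exp (Complex.I * (t : ℂ) * (x : ℂ))) :=
      (integrable_const (1 : ℝ)).mono' (by fun_prop) (ae_of_all _ fun x => (hnorm x).le)
    have hsum : VectorMeasure.integral (G.restrict (↑S : Set ℝ))
        (fun x : ℝ => Complex.exp (Complex.I * (t : ℂ) * (x : ℂ))) (ContinuousLinearMap.mul ℝ ℂ)
        = ∑ x ∈ S, Complex.exp (Complex.I * (t : ℂ) * (x : ℂ)) * G {x} := by
      have hS' : (↑S : Set ℝ) = ⋃ x ∈ S, {x} := by ext; simp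
      rw [hS', VectorMeasure.setIntegral_biUnion_finset S
        (fun x _ => measurableSet_singleton x) (fun x _ y _ hxy => Set.disjoint_singleton.2 hxy)
        (fun x _ => hi.integrableOn)]
      refine Finset.sum_congr rfl fun x _ => ?_
      rw [VectorMeasure.integral_singleton, ContinuousLinearMap.mul_apply']
    rw [← hsum, fourierStieltjes, ← VectorMeasure.setIntegral_compl S.measurableSet hi]
    have hfr : (G.restrict (↑S : Set ℝ)ᶜ).variation = G.variation.restrict (↑S : Set ℝ)ᶜ :=
      VectorMeasure.variation_restrict S.measurableSet.compl
    have hfm' : IsFiniteMeasure (G.restrict (↑S : Set ℝ)ᶜ).variation := by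
      rw [hfr]; infer_instance
    refine (VectorMeasure.norm_integral_le_of_norm_le_const (C := 1)
      (ae_of_all _ fun x => (hnorm x).le)).trans ?_
    rw [hfr, measureReal_restrict_apply MeasurableSet.univ, Set.univ_inter, one_mul]
    exact (mul_le_of_le_one_left measureReal_nonneg
      (ContinuousLinearMap.opNorm_mul_le ℝ ℂ)).trans hSη

/-! ### The two parts of the inversion integral -/

/-- On a bounded interval the error integrals vanish in the limit, by dominated convergence: the
`m`-powers tend to `0` wherever the characteristic function of the error does not vanish. -/
lemma tendsto_integral_errIntegrand_zero {μX ν : Measure ℝ} [IsProbabilityMeasure μX]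
    [IsProbabilityMeasure ν] (hp : ∀ t, (charFun ν t).re ∈ Set.Icc (0 : ℝ) 1)
    (hint : IntegrableNearZero ν) (hnull : ∀ᵐ t : ℝ, (charFun ν t).re ≠ 0) (ξ : ℝ)
    {A : ℝ} (hA : 0 ≤ A) :
    Tendsto (fun m => ∫ t in (0 : ℝ)..A, errIntegrand μX ν ξ m t) atTop (𝓝 0) := by
  simp only [intervalIntegral.integral_of_le hA]
  suffices h : Tendsto (fun m => ∫ t in Set.Ioc 0 A, errIntegrand μX ν ξ m t) atTop
      (𝓝 (∫ _ in Set.Ioc 0 A, (0 : ℝ))) by simpa using h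
  refine tendsto_integral_of_dominated_convergence (fun t => mPower ν t 0 / t)
    (fun m => (measurable_errIntegrand ξ m).aestronglyMeasurable)
    (integrableOn_mPower_zero_div hp hint A) (fun m => ?_) ?_
  · filter_upwards [ae_restrict_mem measurableSet_Ioc] with t ht
    exact norm_errIntegrand_le_zero hp ξ m ht.1
  · filter_upwards [ae_restrict_mem measurableSet_Ioc, ae_restrict_of_ae hnull] with t ht ht0
    have hpos : 0 < (charFun ν t).re := lt_of_le_of_ne (hp t).1 (Ne.symm ht0)
    have h1 : Tendsto (fun m => mPower ν t m / t) atTop (𝓝 (0 / t)) :=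
      (((tendsto_pow_atTop_nhds_zero_of_lt_one (by linarith [(hp t).2])
        (by linarith)).comp (tendsto_add_atTop_nat 1))).div_const t
    rw [zero_div] at h1
    exact squeeze_zero_norm (fun m => norm_errIntegrand_le hp ξ m ht.1) h1

/-- The bound of `norm_integral_exp_mul_le`, summed over the atoms of a purely atomic measure. -/
lemma norm_integral_exp_mul_fourierStieltjes_le {G : ComplexMeasure ℝ}
    (hfin : G.variation Set.univ < ∞) (hat : G.variation Set.univ = G.variation (atoms G))
    {A ρ V κ ξ : ℝ} (hρ : 0 < ρ) (hκ : 0 < κ)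
    (hθ : ∀ x ∈ atoms G, κ ≤ ‖1 - Complex.exp ((ρ * (x - ξ) : ℝ) * Complex.I)‖)
    {ψ : ℝ → ℂ} (hψ : ContinuousOn ψ (Set.Ici A))
    (hvar : eVariationOn ψ (Set.Ici A) ≤ ENNReal.ofReal V) (hsup : ∀ t ∈ Set.Ici A, ‖ψ t‖ ≤ V)
    {P : ℝ → ℝ} (hP : Continuous P) (hP01 : ∀ t, P t ∈ Set.Icc (0 : ℝ) 1)
    (hmono : ∀ s ∈ Set.Icc 0 ρ, Monotone (fun j : ℕ => P (A + s + j * ρ)) ∨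
      Antitone (fun j : ℕ => P (A + s + j * ρ))) (N : ℕ)
    (hii : IntervalIntegrable (fun t => Complex.exp (-(t * ξ : ℝ) * Complex.I) *
      (fourierStieltjes G t * ψ t * P t)) volume A (A + N * ρ)) :
    ‖∫ t in A..(A + N * ρ), Complex.exp (-(t * ξ : ℝ) * Complex.I) *
      (fourierStieltjes G t * ψ t * P t)‖ ≤ G.variation.real Set.univ * (4 * V / κ * ρ) := by
  have hV : 0 ≤ V := (norm_nonneg _).trans (hsup A Set.self_mem_Ici)
  have hAN : A ≤ A + N * ρ := by
    have : 0 ≤ (N : ℝ) * ρ := by positivity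
    linarith
  -- it suffices to lose an arbitrarily small multiple of a constant (which depends on `N`)
  suffices h : ∀ η : ℝ, 0 < η → ‖∫ t in A..(A + N * ρ), Complex.exp (-(t * ξ : ℝ) * Complex.I) *
      (fourierStieltjes G t * ψ t * P t)‖
        ≤ G.variation.real Set.univ * (4 * V / κ * ρ) + η * (V * (N * ρ)) by
    have hlim : Tendsto (fun η : ℝ => G.variation.real Set.univ * (4 * V / κ * ρ)
        + η * (V * (N * ρ))) (𝓝[>] 0)
        (𝓝 (G.variation.real Set.univ * (4 * V / κ * ρ) + 0 * (V * (N * ρ)))) :=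
      (((continuous_id.mul continuous_const).tendsto (0 : ℝ)).const_add _).mono_left
        nhdsWithin_le_nhds
    rw [zero_mul, add_zero] at hlim
    exact ge_of_tendsto hlim (eventually_nhdsWithin_of_forall fun η hη => h η hη)
  intro η hη
  obtain ⟨S, hS, hSsum, hSapp⟩ := exists_finset_fourierStieltjes G hfin hat hη
  set g : ℝ → ℝ → ℂ := fun x t =>
    Complex.exp ((t * (x - ξ) : ℝ) * Complex.I) * (ψ t * P t) with hg
  have hgi : ∀ x, IntervalIntegrable (g x) volume A (A + N * ρ) := fun x => by
    refine ContinuousOn.intervalIntegrable ?_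
    rw [Set.uIcc_of_le hAN]
    have h1 : Continuous (fun t : ℝ => Complex.exp ((t * (x - ξ) : ℝ) * Complex.I)) := by fun_prop
    have h2 : Continuous (fun t : ℝ => (P t : ℂ)) := by fun_prop
    exact h1.continuousOn.mul ((hψ.mono Set.Icc_subset_Ici_self).mul h2.continuousOn)
  have hsumi : IntervalIntegrable (fun t => ∑ x ∈ S, G {x} * g x t) volume A (A + N * ρ) := by
    have h := IntervalIntegrable.sum (μ := volume) (a := A) (b := A + N * ρ) S
      (f := fun x t => G {x} * g x t) fun x _ => (hgi x).const_mul _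
    simpa only [Finset.sum_fn] using h
  have hdecomp : ∫ t in A..(A + N * ρ), Complex.exp (-(t * ξ : ℝ) * Complex.I) *
      (fourierStieltjes G t * ψ t * P t)
      = (∑ x ∈ S, G {x} * ∫ t in A..(A + N * ρ), g x t)
        + ∫ t in A..(A + N * ρ), (Complex.exp (-(t * ξ : ℝ) * Complex.I) *
          (fourierStieltjes G t * ψ t * P t) - ∑ x ∈ S, G {x} * g x t) := by
    rw [intervalIntegral.integral_sub hii hsumi,
      intervalIntegral.integral_finsetSum fun x _ => (hgi x).const_mul _]
    simp only [intervalIntegral.integral_const_mul]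
    ring
  rw [hdecomp]
  refine (norm_add_le _ _).trans (add_le_add ?_ ?_)
  · calc ‖∑ x ∈ S, G {x} * ∫ t in A..(A + N * ρ), g x t‖
        ≤ ∑ x ∈ S, ‖G {x}‖ * (4 * V / κ * ρ) := by
          refine (norm_sum_le _ _).trans (Finset.sum_le_sum fun x hx => ?_)
          rw [norm_mul]
          exact mul_le_mul_of_nonneg_left (norm_integral_exp_mul_le hρ hκ (hθ x (hS x hx)) hψ hvar
            hsup hP hP01 hmono N) (norm_nonneg _)
      _ = (∑ x ∈ S, ‖G {x}‖) * (4 * V / κ * ρ) := by rw [Finset.sum_mul]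
      _ ≤ _ := by gcongr
  · have hb : ∀ t ∈ Set.uIoc A (A + N * ρ), ‖Complex.exp (-(t * ξ : ℝ) * Complex.I) *
        (fourierStieltjes G t * ψ t * P t) - ∑ x ∈ S, G {x} * g x t‖ ≤ η * V := by
      intro t ht
      rw [Set.uIoc_of_le hAN] at ht
      have heq : Complex.exp (-(t * ξ : ℝ) * Complex.I) *
          (fourierStieltjes G t * ψ t * P t) - ∑ x ∈ S, G {x} * g x t
          = Complex.exp (-(t * ξ : ℝ) * Complex.I) * ((fourierStieltjes G t
            - ∑ x ∈ S, Complex.exp (Complex.I * (t : ℂ) * (x : ℂ)) * G {x}) * (ψ t * P t)) := by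
        have hx : ∀ x ∈ S, G {x} * g x t = Complex.exp (-(t * ξ : ℝ) * Complex.I) *
            (Complex.exp (Complex.I * (t : ℂ) * (x : ℂ)) * G {x} * (ψ t * P t)) := by
          intro x _
          have he : Complex.exp ((t * (x - ξ) : ℝ) * Complex.I)
              = Complex.exp (-(t * ξ : ℝ) * Complex.I) *
                Complex.exp (Complex.I * (t : ℂ) * (x : ℂ)) := by
            rw [← Complex.exp_add]
            congr 1
            push_cast
            ring
          simp only [hg, he]
          ring
        rw [Finset.sum_congr rfl hx, ← Finset.mul_sum, ← Finset.sum_mul]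
        ring
      rw [heq, norm_mul, ← Complex.ofReal_neg, Complex.norm_exp_ofReal_mul_I, one_mul, norm_mul,
        norm_mul, Complex.norm_real, Real.norm_of_nonneg (hP01 t).1]
      have h1 : ‖ψ t‖ * P t ≤ V :=
        (mul_le_of_le_one_right (norm_nonneg _) (hP01 t).2).trans (hsup t ht.1.le)
      exact mul_le_mul (hSapp t) h1 (mul_nonneg (norm_nonneg _) (hP01 t).1) hη.le
    refine (intervalIntegral.norm_integral_le_of_norm_le_const hb).trans_eq ?_
    rw [add_sub_cancel_left, abs_of_nonneg (by positivity), mul_assoc]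

/-- A function vanishing at infinity is bounded by its variation. -/
lemma norm_le_of_eVariationOn_Ici_le {ψ : ℝ → ℂ} {A V : ℝ} (hV : 0 ≤ V)
    (hvar : eVariationOn ψ (Set.Ici A) ≤ ENNReal.ofReal V) (hlim : Tendsto ψ atTop (𝓝 0))
    {t : ℝ} (ht : t ∈ Set.Ici A) : ‖ψ t‖ ≤ V := by
  have h1 : Tendsto (fun s => ‖ψ t - ψ s‖) atTop (𝓝 ‖ψ t - 0‖) := (hlim.const_sub _).norm
  rw [sub_zero] at h1
  refine le_of_tendsto h1 ?_
  filter_upwards [eventually_ge_atTop A] with s hs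
  have h2 := (eVariationOn.edist_le ψ ht hs).trans hvar
  rwa [edist_dist, ENNReal.ofReal_le_ofReal_iff hV, dist_eq_norm] at h2

/-- The tails of the inversion integrals are small uniformly in `m`. -/
lemma exists_forall_abs_integral_errIntegrand_le {μX ν : Measure ℝ} [IsProbabilityMeasure μX]
    [IsProbabilityMeasure ν] (hp : ∀ t, (charFun ν t).re ∈ Set.Icc (0 : ℝ) 1)
    {ρ : ℝ} (hρ : 0 < ρ) {j₀ : ℕ} (hmono : MonotoneAlongProgressions ν ρ j₀)
    {T₀ : ℝ} {G : ComplexMeasure ℝ} {φ : ℝ → ℂ} (hfac : Factorization μX T₀ G φ) {ξ : ℝ}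
    (hdist : 0 < setDist ((fun x : ℝ => (x - ξ) * ρ) '' atoms G) twoPiInt)
    {ε : ℝ} (hε : 0 < ε) :
    ∃ A : ℝ, 0 < A ∧ ∀ m N : ℕ, |∫ t in A..(A + N * ρ), errIntegrand μX ν ξ m t| ≤ ε := by
  obtain ⟨κ, hκ, hθ⟩ := exists_pos_le_norm_one_sub_exp hdist
  set Λ := G.variation.real Set.univ with hΛ
  have hΛ0 : 0 ≤ Λ := measureReal_nonneg
  set ψ : ℝ → ℂ := fun t => φ t / (t : ℂ) with hψ
  -- the tail variation that brings the bound `Λ (4 V / κ) ρ` below `ε`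
  set V : ℝ := ε * κ / (4 * ρ * (Λ + 1)) with hVdef
  have hV : 0 < V := by positivity
  have hVε : Λ * (4 * V / κ * ρ) ≤ ε := by
    have : Λ * (4 * V / κ * ρ) = ε * (Λ / (Λ + 1)) := by
      rw [hVdef]
      field_simp
    rw [this]
    exact mul_le_of_le_one_right hε.le ((div_le_one (by linarith)).2 (by linarith))
  obtain ⟨j₁, hj₀, hj1, hjT, hjvar⟩ : ∃ j₁ : ℕ, j₀ ≤ j₁ ∧ 1 ≤ j₁ ∧ T₀ ≤ j₁ * ρ ∧
      eVariationOn ψ (Set.Ici ((j₁ : ℝ) * ρ)) ≤ ENNReal.ofReal V := by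
    have h1 := hfac.boundedVariation.tendsto_eVariationOn_Ici_zero
    rw [inf_eq_right.2 (le_principal_iff.2 (Ici_mem_atTop T₀))] at h1
    have h2 : Tendsto (fun j : ℕ => (j : ℝ) * ρ) atTop atTop :=
      tendsto_natCast_atTop_atTop.atTop_mul_const hρ
    have h3 := (h1.comp h2).eventually (ge_mem_nhds (ENNReal.ofReal_pos.2 hV))
    obtain ⟨j, ha, hb, hc, hd⟩ := ((eventually_ge_atTop j₀).and ((eventually_ge_atTop 1).and
      ((h2.eventually_ge_atTop T₀).and h3))).exists
    refine ⟨j, ha, hb, hc, ?_⟩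
    rwa [Function.comp_apply, Set.inter_eq_right.2 (Set.Ici_subset_Ici.2 hc)] at hd
  have hA : 0 < (j₁ : ℝ) * ρ := mul_pos (by exact_mod_cast hj1) hρ
  refine ⟨j₁ * ρ, hA, fun m N => ?_⟩
  set A := (j₁ : ℝ) * ρ with hAdef
  have hAN : A ≤ A + N * ρ := by
    have : 0 ≤ (N : ℝ) * ρ := by positivity
    linarith
  have hcν : Continuous (charFun ν) := continuous_charFun
  have hcX : Continuous (charFun μX) := continuous_charFun
  have hP : Continuous (fun t => mPower ν t m) := by
    unfold mPower
    fun_prop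
  set F : ℝ → ℂ := fun t => Complex.exp (-(t * ξ : ℝ) * Complex.I) *
      (fourierStieltjes G t * ψ t * (mPower ν t m : ℝ)) with hF
  have hFeq : ∀ t ∈ Set.uIcc A (A + N * ρ), F t = Complex.exp (-(t * ξ : ℝ) * Complex.I) *
      charFun μX t * ((mPower ν t m / t : ℝ) : ℂ) := by
    intro t ht
    rw [Set.uIcc_of_le hAN] at ht
    rw [hfac.eq_mul t (hjT.trans ht.1), hF, hψ]
    push_cast
    ring
  have hFi : IntervalIntegrable F volume A (A + N * ρ) := by
    refine ContinuousOn.intervalIntegrable (ContinuousOn.congr (fun t ht => ?_) hFeq)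
    rw [Set.uIcc_of_le hAN] at ht
    have ht0 : t ≠ 0 := (hA.trans_le ht.1).ne'
    have h1 : ContinuousAt (fun t => mPower ν t m / t) t := hP.continuousAt.div continuousAt_id ht0
    have h2 : ContinuousAt (fun t => ((mPower ν t m / t : ℝ) : ℂ)) t :=
      Complex.continuous_ofReal.continuousAt.comp h1
    have h3 : Continuous (fun t : ℝ => Complex.exp (-(t * ξ : ℝ) * Complex.I) * charFun μX t) := by
      fun_prop
    exact (h3.continuousAt.mul h2).continuousWithinAt
  have him : ∫ t in A..(A + N * ρ), errIntegrand μX ν ξ m t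
      = (∫ t in A..(A + N * ρ), F t).im := by
    rw [intervalIntegral.integral_congr_ae (ae_of_all _ fun t ht => ?_),
      intervalIntegral.integral_of_le hAN, intervalIntegral.integral_of_le hAN]
    · exact integral_im (𝕜 := ℂ) hFi.1
    · change errIntegrand μX ν ξ m t = (F t).im
      rw [hFeq t (Set.uIoc_subset_uIcc ht), Complex.im_mul_ofReal, errIntegrand]
  rw [him]
  refine (Complex.abs_im_le_norm _).trans (le_trans ?_ hVε)
  refine norm_integral_exp_mul_fourierStieltjes_le hfac.finite_variation hfac.purely_atomic hρ hκ
    hθ (hfac.continuousOn.mono (Set.Ici_subset_Ici.2 hjT)) hjvar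
    (fun t ht => norm_le_of_eVariationOn_Ici_le hV.le hjvar hfac.tendsto_zero ht) hP
    (fun t => ⟨mPower_nonneg hp t m, mPower_le_one hp t m⟩) (fun s hs => ?_) N hFi
  -- `A` is a multiple of `ρ` beyond `j₀ρ`, so these are tails of the progressions in `hmono`
  have hshift : ∀ j : ℕ, A + s + j * ρ = s + ((j₁ + j : ℕ) : ℝ) * ρ := fun j => by
    rw [hAdef]
    push_cast
    ring
  simp only [hshift]
  refine (hmono m s hs).imp (fun h i j hij => ?_) (fun h i j hij => ?_) <;>
    exact h (Set.mem_Ici.2 (by omega)) (Set.mem_Ici.2 (by omega)) (by omega)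

end

end Deconv

theorem mainTheorem3
    (μX με μη : Measure ℝ)
    [IsProbabilityMeasure μX] [IsProbabilityMeasure με] [IsProbabilityMeasure μη]
    (hη : Deconv.Symmetrizes μη με)
    (ρ : ℝ) (hρ : 0 < ρ) (j₀ : ℕ)
    (hmono : Deconv.MonotoneAlongProgressions (Deconv.symmErrorLaw με μη) ρ j₀)
    (T₀ : ℝ) (G : ComplexMeasure ℝ) (φ : ℝ → ℂ)
    (hfac : Deconv.Factorization μX T₀ G φ)
    (hint : Deconv.IntegrableNearZero (Deconv.symmErrorLaw με μη))
    (hnull : volume {t : ℝ | charFun με t = 0} = 0)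
    (ξ : ℝ) (hξ : ξ ∈ Deconv.decContinuity μX με μη)
    (hdist : 0 < Deconv.setDist ((fun x : ℝ => (x - ξ) * ρ) '' Deconv.atoms G) Deconv.twoPiInt) :
    Tendsto (fun m : ℕ => Deconv.decFun μX με μη ξ m) atTop
      (𝓝 ((cdf μX ξ + Function.leftLim (cdf μX) ξ) / 2)) := by
  have hc := Deconv.dirichletConst_pos
  have hp := hη.mem_Icc
  have hnull' : ∀ᵐ t : ℝ, (charFun (Deconv.symmErrorLaw με μη) t).re ≠ 0 := by
    have h : ∀ᵐ t : ℝ, ¬ charFun με t = 0 := by simpa [ae_iff] using hnull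
    filter_upwards [h] with t ht h0
    exact ht ((hη.zeros t).1 (Complex.ext h0 (hη.real_valued t)))
  rw [Metric.tendsto_atTop]
  intro ε hε
  obtain ⟨A, hA, htail⟩ := Deconv.exists_forall_abs_integral_errIntegrand_le hp hρ hmono hfac hdist
    (mul_pos hc (half_pos hε))
  have hhead := Deconv.tendsto_integral_errIntegrand_zero (μX := μX) hp hint hnull' ξ hA.le
  obtain ⟨M, hM⟩ := Metric.tendsto_atTop.1 hhead _ (mul_pos hc hε)
  refine ⟨M, fun m hm => ?_⟩
  have hMm := hM m hm
  rw [Real.dist_eq, sub_zero] at hMm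
  -- the improper integral converges, so the endpoints may be restricted to `A + Nρ`
  have hseq : Tendsto (fun N : ℕ => A + N * ρ) atTop atTop :=
    tendsto_atTop_add_const_left _ _ (tendsto_natCast_atTop_atTop.atTop_mul_const hρ)
  have hlim := ((Deconv.tendsto_integral_errIntegrand hη hint hξ m).comp hseq).abs
  have hle : |2 * Deconv.dirichletConst *
      (Deconv.decFun μX με μη ξ m - (cdf μX ξ + Function.leftLim (cdf μX) ξ) / 2)|
      ≤ |∫ t in (0 : ℝ)..A, Deconv.errIntegrand μX (Deconv.symmErrorLaw με μη) ξ m t|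
        + Deconv.dirichletConst * (ε / 2) := by
    refine le_of_tendsto hlim (Eventually.of_forall fun N => ?_)
    have hN : 0 ≤ (N : ℝ) * ρ := by positivity
    have hi := Deconv.integrableOn_errIntegrand (μX := μX) hp hint ξ m (A + N * ρ)
    rw [Function.comp_apply, ← intervalIntegral.integral_add_adjacent_intervals (b := A)
      ((intervalIntegrable_iff_integrableOn_Ioc_of_le hA.le).2
        (hi.mono_set (Set.Ioc_subset_Ioc_right (by linarith))))
      ((intervalIntegrable_iff_integrableOn_Ioc_of_le (by linarith)).2
        (hi.mono_set (Set.Ioc_subset_Ioc_left hA.le)))]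
    exact (abs_add_le _ _).trans (add_le_add_right (htail m N) _)
  rw [abs_mul, abs_of_pos (by positivity : 0 < 2 * Deconv.dirichletConst)] at hle
  rw [Real.dist_eq]
  nlinarith
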